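/- Let $0<\alpha\le \tfrac12$ and let $f_\alpha$ be the one-sided $\alpha$-stable density, i.e. the unique positive continuous function on $(0,\infty)$ that is integrable and satisfies $$\int_0^\infty e^{-\lambda x} f_\alpha(x)\,dx = e^{-\lambda^\alpha}\qquad\text{for all }\lambda\ge 0 .$$ Then $t\mapsto \ln f_\alpha(e^t)$ is twice continuously differentiable on $\mathbb{R}$, and 1. $\displaystyle \frac{d}{dt}\ln f_\alpha(e^t) = \alpha^{1/(1-\alpha)}\exp\!\Big(\frac{\alpha}{\alpha-1}\,t\Big) + O(1)$ as $t\to-\infty$ (the implied constant may depend on $\alpha$); 2. $\displaystyle \frac{d^2}{dt^2}\ln f_\alpha(e^t)\to-\infty$ as $t\to-\infty$. -/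

import Mathlib

open Set Filter Asymptotics MeasureTheory

/-- `f` is the one-sided `α`-stable density: the positive density on `(0, ∞)` with
`∫₀^∞ exp (-l x) f x dx = exp (-l ^ α)` for all `l ≥ 0` (for `l = 0`, `α > 0` this is the
normalization `∫₀^∞ f = 1`). A Laplace transform determines a density only almost everywhere;
continuity on `(0, ∞)` selects the version whose values are meant, and determines `f` at every
point of `(0, ∞)`. The values of `f` on `(-∞, 0]` play no role. -/
structure IsOneSidedStableDensity (α : ℝ) (f : ℝ → ℝ) : Prop where
  continuousOn : ContinuousOn f (Ioi 0)
  pos : ∀ x : ℝ, 0 < x → 0 < f x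
  integrableOn : IntegrableOn f (Ioi 0)
  laplace : ∀ l : ℝ, 0 ≤ l →
    ∫ x in Ioi (0 : ℝ), Real.exp (-(l * x)) * f x = Real.exp (-(l ^ α))

/-!
The proof is the saddle point method, applied to the Laplace inversion integral of the density.

Both sides of `∫ exp (-l x) f x dx = exp (-l ^ α)` are analytic in the right half-plane, so the
identity holds there (`IsOneSidedStableDensity.laplace_complex`). Fourier inversion of
`x ↦ exp (-c x) f x`, at the points `x > 0` where it is continuous, then gives
`f x = (2 π)⁻¹ ∫ exp (x z - z ^ α) dz / i` over the line `Re z = c`, *for every* `c > 0`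
(`IsOneSidedStableDensity.eq_inversionIntegral`); no contour has to be moved. On such a line the
integrand decays like `exp (-b |z| ^ α)`, so `f` may be differentiated under the integral, each
derivative bringing down a factor `z`.

For given `x` let `c` be the saddle point, `x = α c ^ (α - 1)`, and put `N = c ^ α`,
`z = c (1 + i v)`. The exponent becomes `(α - 1) N + N φ(v)`, where
`φ(v) = 1 + α i v - (1 + i v) ^ α` is `phase α v`. With the moments
`A k = ∫ v ^ k exp (N φ(v)) dv` (`saddleMoment`) and `g t = log (f (exp t))`, the substitution `x = exp t` yields
`g' = α N (1 + i A 1 / A 0)` and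
`g'' = α N (1 + i A 1 / A 0) - (α N) ^ 2 (A 2 / A 0 - (A 1 / A 0) ^ 2)`.

As `t → -∞` one has `N → ∞`, and `α N` is exactly the claimed main term of `g'`. Since
`Re φ(v) ≤ -(1 - α) ((1 + v ^ 2) ^ (α / 2) - 1)` (`phase_re_le`), the absolute moment of order `k`
is `O (N ^ (-(k + 1) / 2))`, and `A 0` is of exact order `N ^ (-1/2)`. That alone would only bound
`A 1 / A 0` by `N ^ (-1/2)`. The gain comes from integration by parts: as
`φ'(v) = -α (1 - α) v + O (v ^ 2)`, the vanishing of `∫ (exp (N φ))'` gives `A 1 / A 0 = O (1 / N)`,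
and that of `∫ (v exp (N φ))'` gives `N α (1 - α) A 2 / A 0 = 1 + O (N ^ (-1/2))`. Hence
`g' = α N + O (1)` and `g'' = α N - α N / (1 - α) + O (√N) = -α ^ 2 N / (1 - α) + O (√N)`.
-/

/-! ### The phase at the saddle point -/

/-- The phase `1 + α i v - (1 + i v) ^ α`. On the vertical line through the saddle point `c` of
`z ↦ z x - z ^ α`, with `z = c (1 + i v)`, the exponent is `(α - 1) c ^ α + c ^ α * phase α v`. -/
noncomputable def phase (α v : ℝ) : ℂ :=
  1 + α * (v * Complex.I) - (1 + v * Complex.I) ^ (α : ℂ)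

/-- The derivative of `phase α`. -/
noncomputable def phaseDeriv (α v : ℝ) : ℂ :=
  α * Complex.I * (1 - (1 + v * Complex.I) ^ ((α : ℂ) - 1))

lemma one_add_mul_I_re (v : ℝ) : (1 + v * Complex.I : ℂ).re = 1 := by simp

lemma one_add_mul_I_mem_slitPlane (v : ℝ) : (1 + v * Complex.I : ℂ) ∈ Complex.slitPlane := by
  left; simp

lemma one_add_mul_I_ne_zero (v : ℝ) : (1 + v * Complex.I : ℂ) ≠ 0 :=
  Complex.slitPlane_ne_zero (one_add_mul_I_mem_slitPlane v)

lemma one_le_norm_one_add_mul_I (v : ℝ) : 1 ≤ ‖(1 + v * Complex.I : ℂ)‖ := by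
  have := Complex.re_le_norm (1 + v * Complex.I : ℂ)
  rwa [one_add_mul_I_re] at this

lemma norm_one_add_mul_I_sq (v : ℝ) : ‖(1 + v * Complex.I : ℂ)‖ ^ 2 = 1 + v ^ 2 := by
  rw [Complex.sq_norm, Complex.normSq_apply]; simp; ring

lemma norm_one_add_mul_I_rpow (v b : ℝ) :
    ‖(1 + v * Complex.I : ℂ)‖ ^ b = (1 + v ^ 2) ^ (b / 2) := by
  rw [← norm_one_add_mul_I_sq, ← Real.rpow_natCast, ← Real.rpow_mul (norm_nonneg _)]
  congr 1; push_cast; ring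

lemma hasDerivAt_one_add_mul_I_cpow (b : ℂ) (v : ℝ) :
    HasDerivAt (fun w : ℝ => (1 + w * Complex.I : ℂ) ^ b)
      (b * (1 + v * Complex.I) ^ (b - 1) * Complex.I) v := by
  have h : HasDerivAt (fun z : ℂ => 1 + z * Complex.I) Complex.I v := by
    simpa using ((hasDerivAt_id (v : ℂ)).mul_const Complex.I).const_add 1
  exact (h.cpow_const (one_add_mul_I_mem_slitPlane v)).comp_ofReal

lemma norm_one_add_mul_I_cpow (b v : ℝ) :
    ‖(1 + v * Complex.I : ℂ) ^ (b : ℂ)‖ = ‖(1 + v * Complex.I : ℂ)‖ ^ b := by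
  rw [Complex.norm_cpow_of_ne_zero (one_add_mul_I_ne_zero v)]; simp

lemma norm_one_add_mul_I_cpow_le_one {b : ℝ} (hb : b ≤ 0) (v : ℝ) :
    ‖(1 + v * Complex.I : ℂ) ^ (b : ℂ)‖ ≤ 1 := by
  rw [norm_one_add_mul_I_cpow]
  exact Real.rpow_le_one_of_one_le_of_nonpos (one_le_norm_one_add_mul_I v) hb

lemma hasDerivAt_phase (α v : ℝ) : HasDerivAt (phase α) (phaseDeriv α v) v := by
  have h1 : HasDerivAt (fun w : ℝ => (1 + α * (w * Complex.I) : ℂ)) (α * Complex.I) v := by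
    simpa using (((Complex.ofRealCLM.hasDerivAt (x := v)).mul_const Complex.I).const_mul
      (α : ℂ)).const_add 1
  refine (h1.sub (hasDerivAt_one_add_mul_I_cpow α v)).congr_deriv ?_
  rw [phaseDeriv]; ring

lemma continuous_phase (α : ℝ) : Continuous (phase α) :=
  continuous_iff_continuousAt.2 fun v => (hasDerivAt_phase α v).continuousAt

lemma continuous_phaseDeriv (α : ℝ) : Continuous (phaseDeriv α) := by
  have : Continuous fun w : ℝ => (1 + w * Complex.I : ℂ) ^ ((α : ℂ) - 1) :=
    continuous_iff_continuousAt.2 fun v => (hasDerivAt_one_add_mul_I_cpow _ v).continuousAt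
  unfold phaseDeriv; fun_prop

lemma phase_zero (α : ℝ) : phase α 0 = 0 := by simp [phase]

/-- Mean value inequality on the segment from `0` to `v`. -/
lemma norm_sub_le_mul_abs_of_hasDerivAt {g g' : ℝ → ℂ} (hg : ∀ v, HasDerivAt g (g' v) v) {C v : ℝ}
    (hC : ∀ w, |w| ≤ |v| → ‖g' w‖ ≤ C) : ‖g v - g 0‖ ≤ C * |v| := by
  have := (convex_Icc (-|v|) |v|).norm_image_sub_le_of_norm_hasDerivWithin_le
    (f := g) (f' := g') (C := C) (x := 0) (y := v)
    (fun w _ => (hg w).hasDerivWithinAt) (fun w hw => hC w (abs_le.2 hw))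
    ⟨by simp, abs_nonneg v⟩ (mem_Icc.2 (abs_le.1 le_rfl))
  simpa using this

/-- First-order Taylor bound, from a bound on the second derivative. -/
lemma norm_sub_sub_le_mul_sq_of_hasDerivAt {g g' g'' : ℝ → ℂ} (hg : ∀ v, HasDerivAt g (g' v) v)
    (hg' : ∀ v, HasDerivAt g' (g'' v) v) {C : ℝ} (hC : ∀ w, ‖g'' w‖ ≤ C) (v : ℝ) :
    ‖g v - g 0 - v * g' 0‖ ≤ C * v ^ 2 := by
  have hC0 : 0 ≤ C := (norm_nonneg _).trans (hC 0)
  have h := norm_sub_le_mul_abs_of_hasDerivAt (g := fun w => g w - w * g' 0)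
    (g' := fun w => g' w - g' 0) (C := C * |v|) (v := v)
    (fun w => by
      refine ((hg w).sub
        ((Complex.ofRealCLM.hasDerivAt (x := w)).mul_const (g' 0))).congr_deriv ?_
      simp)
    (fun w hw => (norm_sub_le_mul_abs_of_hasDerivAt hg' (C := C) (v := w) fun u _ => hC u).trans
      (by gcongr))
  rw [mul_assoc, ← sq, sq_abs] at h
  simpa [sub_right_comm] using h

/-- `phaseDeriv α v = - α (1 - α) v + O (v ^ 2)`. -/
lemma norm_phaseDeriv_add_le {α : ℝ} (h0 : 0 < α) (h1 : α < 1) (v : ℝ) :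
    ‖phaseDeriv α v + α * (1 - α) * v‖ ≤ 2 * v ^ 2 := by
  have hd : ∀ v : ℝ, HasDerivAt (phaseDeriv α)
      (-(α * Complex.I * (((α : ℂ) - 1) * (1 + v * Complex.I) ^ ((α : ℂ) - 1 - 1) * Complex.I)))
      v := fun v => by
    refine (((hasDerivAt_one_add_mul_I_cpow ((α : ℂ) - 1) v).const_sub 1).const_mul
      (α * Complex.I : ℂ)).congr_deriv ?_
    ring
  have hd' : ∀ v : ℝ, HasDerivAt (fun v : ℝ => -(α * Complex.I * (((α : ℂ) - 1) *
      (1 + v * Complex.I) ^ ((α : ℂ) - 1 - 1) * Complex.I)))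
      (α * Complex.I * (((α : ℂ) - 1) * ((α : ℂ) - 1 - 1) *
        (1 + v * Complex.I) ^ ((α : ℂ) - 1 - 1 - 1))) v := fun v => by
    refine ((((hasDerivAt_one_add_mul_I_cpow ((α : ℂ) - 1 - 1) v).const_mul
      ((α : ℂ) - 1)).mul_const Complex.I).const_mul (α * Complex.I : ℂ)).neg.congr_deriv ?_
    linear_combination (-(α * Complex.I * (((α : ℂ) - 1) * ((α : ℂ) - 1 - 1) *
        (1 + v * Complex.I) ^ ((α : ℂ) - 1 - 1 - 1)))) * Complex.I_mul_I
  have hb : ∀ v : ℝ, ‖(α * Complex.I * (((α : ℂ) - 1) * ((α : ℂ) - 1 - 1) *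
        (1 + v * Complex.I) ^ ((α : ℂ) - 1 - 1 - 1)) : ℂ)‖ ≤ 2 := fun v => by
    have e1 : ((α : ℂ) - 1 - 1 - 1) = ((α - 1 - 1 - 1 : ℝ) : ℂ) := by push_cast; ring
    have e2 : ((α : ℂ) - 1) * ((α : ℂ) - 1 - 1) = (((1 - α) * (2 - α) : ℝ) : ℂ) := by
      push_cast; ring
    have h := norm_one_add_mul_I_cpow_le_one (b := α - 1 - 1 - 1) (by linarith) v
    rw [e1, e2, norm_mul, norm_mul, norm_mul, Complex.norm_real, Complex.norm_real,
      Complex.norm_I, Real.norm_of_nonneg h0.le,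
      Real.norm_of_nonneg (by nlinarith : 0 ≤ (1 - α) * (2 - α))]
    have h1' : 0 ≤ 1 - α := by linarith
    have h2' : 0 ≤ 2 - α := by linarith
    calc α * 1 * ((1 - α) * (2 - α) * _) ≤ 1 * 1 * ((1 * 2) * 1) := by
          gcongr <;> linarith
      _ = 2 := by norm_num
  have := norm_sub_sub_le_mul_sq_of_hasDerivAt hd hd' hb v
  convert this using 2
  simp only [phaseDeriv, Complex.ofReal_zero, zero_mul, add_zero, Complex.one_cpow, sub_self,
    mul_zero, sub_zero]
  linear_combination (α * (1 - α) * v : ℂ) * Complex.I_mul_I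

/-- `phase α v = - α (1 - α) v ^ 2 / 2 + O (v ^ 3)`. -/
lemma norm_phase_add_le {α : ℝ} (h0 : 0 < α) (h1 : α < 1) (v : ℝ) :
    ‖phase α v + α * (1 - α) / 2 * v ^ 2‖ ≤ 2 * |v| ^ 3 := by
  have h := norm_sub_le_mul_abs_of_hasDerivAt
    (g := fun w => phase α w + α * (1 - α) / 2 * (w : ℂ) ^ 2)
    (g' := fun w => phaseDeriv α w + α * (1 - α) * w) (C := 2 * |v| ^ 2) (v := v)
    (fun w => by
      refine ((hasDerivAt_phase α w).add (((Complex.ofRealCLM.hasDerivAt (x := w)).pow 2).const_mul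
        (α * (1 - α) / 2 : ℂ))).congr_deriv ?_
      simp; ring)
    (fun w hw => (norm_phaseDeriv_add_le h0 h1 w).trans (by
      rw [← sq_abs w]; gcongr))
  have e : (2 * |v| ^ 2) * |v| = 2 * |v| ^ 3 := by ring
  rw [e] at h
  simpa [phase_zero] using h

/-- The derivative estimate behind `le_re_one_add_mul_I_cpow`: it amounts to
`(1 - α) sin θ ≤ sin ((1 - α) θ)` for the argument `θ` of `1 + i v`. -/
lemma mul_rpow_le_re_cpow_mul_I {α v : ℝ} (h0 : 0 < α) (h1 : α < 1) (hv : 0 ≤ v) :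
    (1 - α) * v * ‖(1 + v * Complex.I : ℂ)‖ ^ (α - 2) ≤
      ((1 + v * Complex.I : ℂ) ^ ((α : ℂ) - 1) * Complex.I).re := by
  set z : ℂ := 1 + v * Complex.I with hz
  have hz0 : z ≠ 0 := one_add_mul_I_ne_zero v
  have hr : 0 < ‖z‖ := norm_pos_iff.2 hz0
  have him : ‖z‖ * Real.sin z.arg = v := by rw [Complex.norm_mul_sin_arg]; simp [hz]
  have hθ0 : 0 ≤ z.arg := Complex.arg_nonneg_iff.2 (by simp [hz, hv])
  have hθπ : z.arg ≤ Real.pi := Complex.arg_le_pi z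
  have hsin : (1 - α) * Real.sin z.arg ≤ Real.sin ((1 - α) * z.arg) := by
    have := strictConcaveOn_sin_Icc.concaveOn.2 ⟨hθ0, hθπ⟩
      ⟨le_rfl, Real.pi_pos.le⟩ (by linarith : 0 ≤ 1 - α) h0.le (by ring)
    simpa using this
  have hre : (z ^ ((α : ℂ) - 1) * Complex.I).re = ‖z‖ ^ (α - 1) * Real.sin ((1 - α) * z.arg) := by
    have e : ((α : ℂ) - 1) = ((α - 1 : ℝ) : ℂ) := by push_cast; ring
    have e2 : (1 - α) * z.arg = -(z.arg * (α - 1)) := by ring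
    rw [Complex.mul_I_re, e, Complex.cpow_ofReal_im, e2, Real.sin_neg]
    ring
  rw [hre]
  have e3 : ‖z‖ ^ (α - 1) = ‖z‖ ^ (α - 2) * ‖z‖ := by
    rw [← Real.rpow_add_one hr.ne']; congr 1; ring
  calc (1 - α) * v * ‖z‖ ^ (α - 2) = ‖z‖ ^ (α - 1) * ((1 - α) * Real.sin z.arg) := by
        rw [e3, ← him]; ring
    _ ≤ _ := by gcongr

/-- Lower bound for the real part of `(1 + i v) ^ α`; it controls the decay of the integrand away
from the saddle point. -/
lemma le_re_one_add_mul_I_cpow {α : ℝ} (h0 : 0 < α) (h1 : α < 1) (v : ℝ) :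
    α + (1 - α) * (1 + v ^ 2) ^ (α / 2) ≤ ((1 + v * Complex.I : ℂ) ^ (α : ℂ)).re := by
  -- both sides are even in `v`
  wlog hv : 0 ≤ v generalizing v
  · have := this (-v) (by linarith)
    have hc : (1 + ((-v : ℝ) : ℂ) * Complex.I) = (starRingEnd ℂ) (1 + v * Complex.I) := by
      simp
    rw [hc, Complex.conj_cpow _ _ (Complex.slitPlane_arg_ne_pi (one_add_mul_I_mem_slitPlane v)),
      Complex.conj_re, Complex.conj_ofReal, neg_sq] at this
    exact this
  let D : ℝ → ℝ := fun v =>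
    ((1 + v * Complex.I : ℂ) ^ (α : ℂ)).re - (1 - α) * (1 + v ^ 2) ^ (α / 2)
  have hD : ∀ w : ℝ, HasDerivAt D (((α : ℂ) * (1 + w * Complex.I) ^ ((α : ℂ) - 1) * Complex.I).re -
      (1 - α) * (2 * w * (α / 2) * (1 + w ^ 2) ^ (α / 2 - 1))) w := fun w => by
    refine (Complex.reCLM.hasFDerivAt.comp_hasDerivAt w
      (hasDerivAt_one_add_mul_I_cpow (α : ℂ) w)).sub (HasDerivAt.const_mul _ ?_)
    have : HasDerivAt (fun x : ℝ => 1 + x ^ 2) (2 * w) w := by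
      simpa using ((hasDerivAt_id w).pow 2).const_add 1
    exact this.rpow_const (Or.inl (by positivity))
  have hmono : MonotoneOn D (Ici 0) := by
    refine monotoneOn_of_deriv_nonneg (convex_Ici 0)
      (fun w _ => (hD w).continuousAt.continuousWithinAt)
      (fun w _ => (hD w).differentiableAt.differentiableWithinAt) fun w hw => ?_
    rw [interior_Ici] at hw
    have hw0 : 0 ≤ w := le_of_lt hw
    have := mul_le_mul_of_nonneg_left (mul_rpow_le_re_cpow_mul_I h0 h1 hw0) h0.le
    rw [norm_one_add_mul_I_rpow, show (α - 2) / 2 = α / 2 - 1 by ring] at this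
    rw [(hD w).deriv, mul_assoc (α : ℂ), Complex.re_ofReal_mul]
    linarith
  have := hmono self_mem_Ici (show v ∈ Ici 0 from hv) hv
  simp [D] at this
  linarith

lemma phase_re_le {α : ℝ} (h0 : 0 < α) (h1 : α < 1) (v : ℝ) :
    (phase α v).re ≤ -((1 - α) * ((1 + v ^ 2) ^ (α / 2) - 1)) := by
  have := le_re_one_add_mul_I_cpow h0 h1 v
  simp only [phase, Complex.sub_re, Complex.add_re, Complex.one_re,
    Complex.mul_re, Complex.ofReal_re, Complex.I_re, Complex.ofReal_im, Complex.I_im]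
  linarith

lemma abs_rpow_le_one_add_sq_rpow {α : ℝ} (h0 : 0 < α) (v : ℝ) :
    |v| ^ α ≤ (1 + v ^ 2) ^ (α / 2) := by
  have : |v| ^ α = (v ^ 2) ^ (α / 2) := by
    rw [← sq_abs, ← Real.rpow_natCast, ← Real.rpow_mul (abs_nonneg v)]
    congr 1; push_cast; ring
  rw [this]
  exact Real.rpow_le_rpow (sq_nonneg v) (by linarith) (by linarith)

/-- After the rescaling `v = w / √N` the Gaussian-scale integrands have, for all `N ≥ 1`, one
integrable majorant: the map `N ↦ N ((1 + s / N) ^ β - 1)` is monotone by concavity. -/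
lemma mul_phase_re_div_sqrt_le {α N : ℝ} (h0 : 0 < α) (h1 : α < 1) (hN : 1 ≤ N) (w : ℝ) :
    N * (phase α (w / √N)).re ≤ -((1 - α) * |w| ^ α) + (1 - α) := by
  have hN0 : 0 < N := by linarith
  have hconc := (Real.concaveOn_rpow (p := α / 2) (by linarith) (by linarith)).2
    (show 1 + w ^ 2 ∈ Ici (0 : ℝ) from mem_Ici.2 (by positivity))
    (show (1 : ℝ) ∈ Ici (0 : ℝ) from mem_Ici.2 zero_le_one) (inv_nonneg.2 hN0.le)
    (sub_nonneg.2 (inv_le_one_of_one_le₀ hN)) (by ring)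
  simp only [smul_eq_mul, Real.one_rpow, mul_one] at hconc
  have e : N⁻¹ * (1 + w ^ 2) + (1 - N⁻¹) = 1 + (w / √N) ^ 2 := by
    rw [div_pow, Real.sq_sqrt hN0.le]; ring
  rw [e] at hconc
  have h2 := mul_le_mul_of_nonneg_left hconc hN0.le
  rw [mul_add, mul_sub, mul_inv_cancel_left₀ hN0.ne', mul_inv_cancel₀ hN0.ne'] at h2
  have h3 := mul_le_mul_of_nonneg_left (phase_re_le h0 h1 (w / √N)) hN0.le
  have h4 := abs_rpow_le_one_add_sq_rpow h0 w
  have h5 : 0 < 1 - α := by linarith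
  nlinarith

/-! ### Moments of the saddle point integrand -/

/-- The moment `∫ v ^ k exp (N phase v) dv` of the saddle point integrand. -/
noncomputable def saddleMoment (α : ℝ) (k : ℕ) (N : ℝ) : ℂ :=
  ∫ v : ℝ, (v : ℂ) ^ k * Complex.exp (N * phase α v)

lemma integrable_abs_pow_mul_exp_neg_mul_abs_rpow {α b : ℝ} (h0 : 0 < α) (hb : 0 < b) (k : ℕ) :
    Integrable fun w : ℝ => |w| ^ k * Real.exp (-(b * |w| ^ α)) := by
  have h := integrableOn_rpow_mul_exp_neg_mul_rpow (s := (k : ℝ)) (p := α) (b := b)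
    (by have := k.cast_nonneg (α := ℝ); linarith) h0 hb
  have hpos : IntegrableOn (fun w : ℝ => |w| ^ k * Real.exp (-(b * |w| ^ α))) (Ioi 0) := by
    refine h.congr_fun (fun w hw => ?_) measurableSet_Ioi
    simp [abs_of_pos (mem_Ioi.1 hw), Real.rpow_natCast]
  rw [← integrableOn_univ, ← Iic_union_Ioi (a := (0 : ℝ)), integrableOn_union]
  refine ⟨?_, hpos⟩
  have hneg : MeasurableEmbedding fun x : ℝ => -x := (Homeomorph.neg ℝ).measurableEmbedding
  rw [← Measure.map_neg_eq_self (volume : Measure ℝ), hneg.integrableOn_map_iff]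
  simpa [Function.comp_def] using (Iff.mpr integrableOn_Ici_iff_integrableOn_Ioi hpos)

lemma norm_cexp_mul_phase (α N v : ℝ) :
    ‖Complex.exp (N * phase α v)‖ = Real.exp (N * (phase α v).re) := by
  rw [Complex.norm_exp, Complex.re_ofReal_mul]

lemma integrable_pow_mul_cexp_phase {α N : ℝ} (h0 : 0 < α) (h1 : α < 1) (hN : 0 < N) (k : ℕ) :
    Integrable fun v : ℝ => (v : ℂ) ^ k * Complex.exp (N * phase α v) := by
  have hc := continuous_phase α
  refine ((integrable_abs_pow_mul_exp_neg_mul_abs_rpow h0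
    (mul_pos hN (sub_pos.2 h1)) k).const_mul (Real.exp (N * (1 - α)))).mono'
    (by fun_prop) (Eventually.of_forall fun v => ?_)
  rw [norm_mul, norm_cexp_mul_phase, norm_pow, Complex.norm_real, Real.norm_eq_abs,
    mul_left_comm, ← Real.exp_add]
  gcongr
  have h2 := abs_rpow_le_one_add_sq_rpow h0 v
  have h3 := phase_re_le h0 h1 v
  have h5 : 0 < 1 - α := by linarith
  have h4 : (phase α v).re ≤ (1 - α) - (1 - α) * |v| ^ α := by nlinarith
  nlinarith

lemma integrable_abs_pow_mul_exp_phase {α N : ℝ} (h0 : 0 < α) (h1 : α < 1) (hN : 0 < N) (k : ℕ) :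
    Integrable fun v : ℝ => |v| ^ k * ‖Complex.exp (N * phase α v)‖ := by
  simpa using (integrable_pow_mul_cexp_phase h0 h1 hN k).norm

/-- The absolute moments live on the Gaussian scale `N ^ (-1/2)`. -/
lemma exists_integral_abs_pow_mul_exp_phase_le {α : ℝ} (h0 : 0 < α) (h1 : α < 1) (k : ℕ) :
    ∃ C, 0 ≤ C ∧ ∀ N : ℝ, 1 ≤ N →
      ∫ v : ℝ, |v| ^ k * ‖Complex.exp (N * phase α v)‖ ≤ C * (√N)⁻¹ ^ (k + 1) := by
  have hint := (integrable_abs_pow_mul_exp_neg_mul_abs_rpow h0 (sub_pos.2 h1) k).const_mul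
    (Real.exp (1 - α))
  refine ⟨∫ w : ℝ, Real.exp (1 - α) * (|w| ^ k * Real.exp (-((1 - α) * |w| ^ α))),
    integral_nonneg fun w => by positivity, fun N hN => ?_⟩
  have hs : 0 < √N := Real.sqrt_pos.2 (by linarith)
  -- substitute `v = w / √N`
  have hsub := Measure.integral_comp_mul_left
    (fun v : ℝ => |v| ^ k * ‖Complex.exp (N * phase α v)‖) (√N)⁻¹
  rw [inv_inv, abs_of_pos hs, smul_eq_mul] at hsub
  have hle : ∫ w : ℝ, |(√N)⁻¹ * w| ^ k * ‖Complex.exp (N * phase α ((√N)⁻¹ * w))‖ ≤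
      ∫ w : ℝ, (√N)⁻¹ ^ k *
        (Real.exp (1 - α) * (|w| ^ k * Real.exp (-((1 - α) * |w| ^ α)))) := by
    refine integral_mono ((integrable_abs_pow_mul_exp_phase h0 h1 (by linarith) k).comp_mul_left'
      (inv_ne_zero hs.ne')) (hint.const_mul _) fun w => ?_
    have h := mul_phase_re_div_sqrt_le h0 h1 hN w
    have e : w / √N = (√N)⁻¹ * w := by rw [div_eq_inv_mul]
    rw [e] at h
    dsimp only
    rw [norm_cexp_mul_phase, abs_mul, abs_of_pos (inv_pos.2 hs), mul_pow, mul_assoc,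
      mul_left_comm (Real.exp (1 - α)), ← Real.exp_add]
    gcongr
    linarith
  rw [hsub, integral_const_mul] at hle
  calc _ = (√N)⁻¹ * (√N * ∫ v : ℝ, |v| ^ k * ‖Complex.exp (N * phase α v)‖) := by
        rw [inv_mul_cancel_left₀ hs.ne']
    _ ≤ _ := mul_le_mul_of_nonneg_left hle (inv_pos.2 hs).le
    _ = _ := by ring

lemma tendsto_mul_phase_div_sqrt {α : ℝ} (h0 : 0 < α) (h1 : α < 1) (w : ℝ) :
    Tendsto (fun N : ℝ => (N : ℂ) * phase α ((√N)⁻¹ * w)) atTop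
      (nhds (-(α * (1 - α) / 2 * w ^ 2))) := by
  rw [tendsto_iff_norm_sub_tendsto_zero]
  have hlim : Tendsto (fun N : ℝ => 2 * |w| ^ 3 * (√N)⁻¹) atTop (nhds 0) := by
    simpa using (tendsto_inv_atTop_zero.comp Real.tendsto_sqrt_atTop).const_mul (2 * |w| ^ 3)
  refine squeeze_zero' (Eventually.of_forall fun _ => norm_nonneg _) ?_ hlim
  filter_upwards [eventually_gt_atTop (0 : ℝ)] with N hN
  have hs : 0 < √N := Real.sqrt_pos.2 hN
  have hNs : N = √N ^ 2 := (Real.sq_sqrt hN.le).symm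
  have h := mul_le_mul_of_nonneg_left (norm_phase_add_le h0 h1 ((√N)⁻¹ * w)) hN.le
  rw [abs_mul, abs_of_pos (inv_pos.2 hs)] at h
  have e1 : N * (2 * ((√N)⁻¹ * |w|) ^ 3) = 2 * |w| ^ 3 * (√N)⁻¹ := by
    rw [hNs, Real.sqrt_sq hs.le]; field_simp
  rw [e1] at h
  refine le_trans (le_of_eq ?_) h
  have hsc : (√N : ℂ) ≠ 0 := by exact_mod_cast hs.ne'
  have hNc : (N : ℂ) = (√N : ℂ) ^ 2 := by exact_mod_cast hNs
  rw [← Real.norm_of_nonneg hN.le, ← Complex.norm_real N, ← norm_mul, Complex.norm_real,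
    Real.norm_of_nonneg hN.le]
  congr 1
  rw [mul_add]
  push_cast
  rw [sub_neg_eq_add]
  congr 1
  rw [hNc]
  field_simp

/-- Laplace's method for the zeroth moment. -/
lemma tendsto_sqrt_mul_saddleMoment_zero {α : ℝ} (h0 : 0 < α) (h1 : α < 1) :
    Tendsto (fun N : ℝ => (√N : ℂ) * saddleMoment α 0 N) atTop
      (nhds (∫ w : ℝ, Complex.exp (-(α * (1 - α) / 2 * w ^ 2)))) := by
  have hcp := continuous_phase α
  have hlim : Tendsto (fun N : ℝ => ∫ w : ℝ, Complex.exp (N * phase α ((√N)⁻¹ * w))) atTop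
      (nhds (∫ w : ℝ, Complex.exp (-(α * (1 - α) / 2 * w ^ 2)))) := by
    refine tendsto_integral_filter_of_dominated_convergence
      (fun w => Real.exp (1 - α) * (|w| ^ 0 * Real.exp (-((1 - α) * |w| ^ α))))
      (Eventually.of_forall fun N => by fun_prop) ?_
      ((integrable_abs_pow_mul_exp_neg_mul_abs_rpow h0 (sub_pos.2 h1) 0).const_mul _)
      (Eventually.of_forall fun w =>
        (Complex.continuous_exp.tendsto _).comp (tendsto_mul_phase_div_sqrt h0 h1 w))
    filter_upwards [eventually_ge_atTop (1 : ℝ)] with N hN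
    refine Eventually.of_forall fun w => ?_
    have h := mul_phase_re_div_sqrt_le h0 h1 hN w
    rw [div_eq_inv_mul] at h
    rw [norm_cexp_mul_phase, pow_zero, one_mul, ← Real.exp_add]
    gcongr
    linarith
  refine hlim.congr' ?_
  filter_upwards [eventually_gt_atTop (0 : ℝ)] with N hN
  have hs : 0 < √N := Real.sqrt_pos.2 hN
  have hsub := Measure.integral_comp_mul_left (fun v : ℝ => Complex.exp (N * phase α v)) (√N)⁻¹
  rw [inv_inv, abs_of_pos hs, Complex.real_smul] at hsub
  simp [saddleMoment, hsub]

lemma exists_le_norm_saddleMoment_zero {α : ℝ} (h0 : 0 < α) (h1 : α < 1) :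
    ∃ c, 0 < c ∧ ∀ᶠ N : ℝ in atTop, c * (√N)⁻¹ ≤ ‖saddleMoment α 0 N‖ := by
  have hb : 0 < α * (1 - α) / 2 := by have := sub_pos.2 h1; positivity
  have hL : (∫ w : ℝ, Complex.exp (-(α * (1 - α) / 2 * w ^ 2))) =
      ((√(Real.pi / (α * (1 - α) / 2)) : ℝ) : ℂ) := by
    rw [← integral_gaussian, ← integral_complex_ofReal]
    congr 1; ext w; push_cast; ring_nf
  have hpos : 0 < √(Real.pi / (α * (1 - α) / 2)) := by positivity
  have h := (tendsto_sqrt_mul_saddleMoment_zero h0 h1).norm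
  rw [hL, Complex.norm_real, Real.norm_of_nonneg hpos.le] at h
  refine ⟨_, half_pos hpos, ?_⟩
  filter_upwards [h.eventually (lt_mem_nhds (half_lt_self hpos)), eventually_gt_atTop (0 : ℝ)]
    with N hN hN0
  have hs : 0 < √N := Real.sqrt_pos.2 hN0
  rw [norm_mul, Complex.norm_real, Real.norm_of_nonneg hs.le] at hN
  rw [← div_eq_mul_inv, div_le_iff₀ hs, mul_comm ‖_‖]
  exact hN.le

lemma hasDerivAt_cexp_mul_phase (α N v : ℝ) :
    HasDerivAt (fun v => Complex.exp (N * phase α v))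
      (N * (phaseDeriv α v * Complex.exp (N * phase α v))) v :=
  (((hasDerivAt_phase α v).const_mul (N : ℂ)).cexp).congr_deriv (by ring)

/-- The integrand of a moment with `v` replaced by the defect of the linear approximation of
`phaseDeriv`. -/
lemma norm_pow_mul_phaseDeriv_add_le {α : ℝ} (h0 : 0 < α) (h1 : α < 1) (k : ℕ) (N v : ℝ) :
    ‖(v : ℂ) ^ k * ((phaseDeriv α v + α * (1 - α) * v) * Complex.exp (N * phase α v))‖ ≤
      2 * (|v| ^ (k + 2) * ‖Complex.exp (N * phase α v)‖) := by
  have h := norm_phaseDeriv_add_le h0 h1 v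
  rw [norm_mul, norm_mul, norm_pow, Complex.norm_real, Real.norm_eq_abs]
  calc |v| ^ k * (_ * _) ≤ |v| ^ k * ((2 * v ^ 2) * ‖Complex.exp (N * phase α v)‖) := by gcongr
    _ = _ := by rw [← sq_abs v]; ring

lemma integrable_pow_mul_phaseDeriv_add {α N : ℝ} (h0 : 0 < α) (h1 : α < 1) (hN : 0 < N) (k : ℕ) :
    Integrable fun v : ℝ =>
      (v : ℂ) ^ k * ((phaseDeriv α v + α * (1 - α) * v) * Complex.exp (N * phase α v)) := by
  have hcp := continuous_phase α
  have hcd := continuous_phaseDeriv α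
  exact ((integrable_abs_pow_mul_exp_phase h0 h1 hN (k + 2)).const_mul 2).mono' (by fun_prop)
    (Eventually.of_forall fun v => norm_pow_mul_phaseDeriv_add_le h0 h1 k N v)

lemma exists_norm_integral_pow_mul_phaseDeriv_add_le {α : ℝ} (h0 : 0 < α) (h1 : α < 1) (k : ℕ) :
    ∃ C, 0 ≤ C ∧ ∀ N : ℝ, 1 ≤ N →
      ‖∫ v : ℝ, (v : ℂ) ^ k *
        ((phaseDeriv α v + α * (1 - α) * v) * Complex.exp (N * phase α v))‖ ≤
        C * (√N)⁻¹ ^ (k + 3) := by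
  obtain ⟨C, hC, h⟩ := exists_integral_abs_pow_mul_exp_phase_le h0 h1 (k + 2)
  refine ⟨2 * C, by positivity, fun N hN => ?_⟩
  refine (norm_integral_le_of_norm_le
    ((integrable_abs_pow_mul_exp_phase h0 h1 (by linarith) (k + 2)).const_mul 2)
    (Eventually.of_forall fun v => norm_pow_mul_phaseDeriv_add_le h0 h1 k N v)).trans ?_
  rw [integral_const_mul, mul_assoc]
  exact mul_le_mul_of_nonneg_left (h N hN) zero_le_two

/-- `v ^ k phaseDeriv v exp (N phase v)` as the difference of the defect and a moment integrand. -/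
lemma pow_mul_phaseDeriv_mul_cexp_eq (α N v : ℝ) (k : ℕ) :
    (v : ℂ) ^ k * (phaseDeriv α v * Complex.exp (N * phase α v)) =
      (v : ℂ) ^ k * ((phaseDeriv α v + α * (1 - α) * v) * Complex.exp (N * phase α v)) -
        α * (1 - α) * ((v : ℂ) ^ (k + 1) * Complex.exp (N * phase α v)) := by
  ring

lemma integrable_pow_mul_phaseDeriv_mul_cexp {α N : ℝ} (h0 : 0 < α) (h1 : α < 1) (hN : 0 < N)
    (k : ℕ) :
    Integrable fun v : ℝ => (v : ℂ) ^ k * (phaseDeriv α v * Complex.exp (N * phase α v)) := by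
  simp_rw [pow_mul_phaseDeriv_mul_cexp_eq]
  exact (integrable_pow_mul_phaseDeriv_add h0 h1 hN k).sub
    ((integrable_pow_mul_cexp_phase h0 h1 hN (k + 1)).const_mul _)

lemma integral_pow_mul_phaseDeriv_mul_cexp {α N : ℝ} (h0 : 0 < α) (h1 : α < 1) (hN : 0 < N)
    (k : ℕ) :
    ∫ v : ℝ, (v : ℂ) ^ k * (phaseDeriv α v * Complex.exp (N * phase α v)) =
      (∫ v : ℝ, (v : ℂ) ^ k *
        ((phaseDeriv α v + α * (1 - α) * v) * Complex.exp (N * phase α v))) -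
        α * (1 - α) * saddleMoment α (k + 1) N := by
  simp_rw [pow_mul_phaseDeriv_mul_cexp_eq]
  rw [integral_sub (integrable_pow_mul_phaseDeriv_add h0 h1 hN k)
    ((integrable_pow_mul_cexp_phase h0 h1 hN (k + 1)).const_mul _), integral_const_mul]
  rfl

/-- Integrating the derivative of `exp (N phase)`: the first moment is `O (N ^ (-3/2))`, a
factor `N ^ (-1/2)` smaller than its absolute counterpart. -/
lemma mul_saddleMoment_one {α N : ℝ} (h0 : 0 < α) (h1 : α < 1) (hN : 0 < N) :
    α * (1 - α) * saddleMoment α 1 N =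
      ∫ v : ℝ, (v : ℂ) ^ 0 *
        ((phaseDeriv α v + α * (1 - α) * v) * Complex.exp (N * phase α v)) := by
  have hi := integrable_pow_mul_phaseDeriv_mul_cexp h0 h1 hN 0
  have h := integral_eq_zero_of_hasDerivAt_of_integrable (hasDerivAt_cexp_mul_phase α N)
    (by simpa using hi.const_mul (N : ℂ))
    (by simpa using integrable_pow_mul_cexp_phase h0 h1 hN 0)
  rw [integral_const_mul, mul_eq_zero] at h
  have h' := h.resolve_left (by exact_mod_cast hN.ne')
  have h2 := integral_pow_mul_phaseDeriv_mul_cexp h0 h1 hN 0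
  simp only [pow_zero, one_mul, zero_add] at h2 ⊢
  rw [h'] at h2
  linear_combination h2

/-- Integrating the derivative of `v exp (N phase v)` relates the zeroth and second moments. -/
lemma saddleMoment_zero_eq {α N : ℝ} (h0 : 0 < α) (h1 : α < 1) (hN : 0 < N) :
    saddleMoment α 0 N = N * (α * (1 - α)) * saddleMoment α 2 N -
      N * ∫ v : ℝ, (v : ℂ) ^ 1 *
        ((phaseDeriv α v + α * (1 - α) * v) * Complex.exp (N * phase α v)) := by
  have hd : ∀ v : ℝ, HasDerivAt (fun v : ℝ => (v : ℂ) ^ 1 * Complex.exp (N * phase α v))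
      ((v : ℂ) ^ 0 * Complex.exp (N * phase α v) +
        N * ((v : ℂ) ^ 1 * (phaseDeriv α v * Complex.exp (N * phase α v)))) v := fun v => by
    have h1 : HasDerivAt (fun v : ℝ => (v : ℂ)) 1 v := Complex.ofRealCLM.hasDerivAt
    simp only [pow_one]
    refine (h1.mul (hasDerivAt_cexp_mul_phase α N v)).congr_deriv ?_
    ring
  have hi0 := integrable_pow_mul_cexp_phase h0 h1 hN 0
  have hi1 := (integrable_pow_mul_phaseDeriv_mul_cexp h0 h1 hN 1).const_mul (N : ℂ)
  have h := integral_eq_zero_of_hasDerivAt_of_integrable hd (hi0.add hi1)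
    (integrable_pow_mul_cexp_phase h0 h1 hN 1)
  rw [integral_add hi0 hi1, integral_const_mul, integral_pow_mul_phaseDeriv_mul_cexp h0 h1 hN 1,
    ← saddleMoment] at h
  linear_combination h

lemma exists_norm_saddleMoment_one_div_le {α : ℝ} (h0 : 0 < α) (h1 : α < 1) :
    ∃ C, 0 ≤ C ∧ ∀ᶠ N : ℝ in atTop,
      ‖saddleMoment α 1 N / saddleMoment α 0 N‖ ≤ C * N⁻¹ := by
  obtain ⟨c, hc, hlow⟩ := exists_le_norm_saddleMoment_zero h0 h1
  obtain ⟨C, hC, hup⟩ := exists_norm_integral_pow_mul_phaseDeriv_add_le h0 h1 0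
  have hκ : 0 < α * (1 - α) := mul_pos h0 (sub_pos.2 h1)
  refine ⟨C / (α * (1 - α)) / c, by positivity, ?_⟩
  filter_upwards [hlow, eventually_ge_atTop (1 : ℝ)] with N hN hN1
  have hN0 : 0 < N := by linarith
  have hs : 0 < √N := Real.sqrt_pos.2 hN0
  have h := hup N hN1
  rw [← mul_saddleMoment_one h0 h1 hN0, norm_mul] at h
  have e : ‖(α * (1 - α) : ℂ)‖ = α * (1 - α) := by
    rw [← Real.norm_of_nonneg hκ.le, ← Complex.norm_real]; push_cast; rfl
  rw [e] at h
  have hlow0 : 0 < c * (√N)⁻¹ := by positivity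
  rw [norm_div, div_le_iff₀ (hlow0.trans_le hN)]
  calc ‖saddleMoment α 1 N‖ ≤ C * (√N)⁻¹ ^ (0 + 3) / (α * (1 - α)) := by
        rw [le_div_iff₀ hκ]; linarith
    _ = C / (α * (1 - α)) / c * N⁻¹ * (c * (√N)⁻¹) := by
        rw [← Real.sq_sqrt hN0.le, Real.sqrt_sq hs.le, inv_pow]; field_simp
    _ ≤ _ := by gcongr

lemma exists_norm_saddleMoment_two_div_sub_le {α : ℝ} (h0 : 0 < α) (h1 : α < 1) :
    ∃ C, 0 ≤ C ∧ ∀ᶠ N : ℝ in atTop,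
      ‖N * (α * (1 - α)) * (saddleMoment α 2 N / saddleMoment α 0 N) - 1‖ ≤ C * (√N)⁻¹ := by
  obtain ⟨c, hc, hlow⟩ := exists_le_norm_saddleMoment_zero h0 h1
  obtain ⟨C, hC, hup⟩ := exists_norm_integral_pow_mul_phaseDeriv_add_le h0 h1 1
  refine ⟨C / c, by positivity, ?_⟩
  filter_upwards [hlow, eventually_ge_atTop (1 : ℝ)] with N hN hN1
  have hN0 : 0 < N := by linarith
  have hs : 0 < √N := Real.sqrt_pos.2 hN0
  have hlow0 : 0 < c * (√N)⁻¹ := by positivity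
  have hA0 : saddleMoment α 0 N ≠ 0 := norm_pos_iff.1 (hlow0.trans_le hN)
  have h := mul_le_mul_of_nonneg_left (hup N hN1) hN0.le
  have e := saddleMoment_zero_eq h0 h1 hN0
  set R := ∫ v : ℝ, (v : ℂ) ^ 1 *
        ((phaseDeriv α v + α * (1 - α) * v) * Complex.exp (N * phase α v))
  have e2 : N * (α * (1 - α)) * (saddleMoment α 2 N / saddleMoment α 0 N) - 1 =
      N * R / saddleMoment α 0 N := by
    field_simp; linear_combination -e
  rw [e2, norm_div, norm_mul, Complex.norm_real, Real.norm_of_nonneg hN0.le,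
    div_le_iff₀ (hlow0.trans_le hN)]
  calc N * ‖R‖ ≤ N * (C * (√N)⁻¹ ^ (1 + 3)) := h
    _ = C / c * (√N)⁻¹ * (c * (√N)⁻¹) := by
        rw [← Real.sq_sqrt hN0.le, Real.sqrt_sq hs.le, inv_pow]; field_simp; ring
    _ ≤ _ := by gcongr

/-! ### The inversion integral on a vertical line -/

/-- The Laplace inversion integral of `z ^ k exp (x z - z ^ α)` over the line `Re z = c`, with
`z = c (1 + i v)` and up to the factor `c ^ (k + 1) / (2 π)`. -/
noncomputable def inversionIntegral (α : ℝ) (k : ℕ) (c x : ℝ) : ℂ :=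
  ∫ v : ℝ, (1 + v * Complex.I) ^ k *
    Complex.exp (c * x * (1 + v * Complex.I) - (c ^ α : ℝ) * (1 + v * Complex.I) ^ (α : ℂ))

lemma exponent_eq_phase (α N y v : ℝ) :
    (y * (1 + v * Complex.I) - N * (1 + v * Complex.I) ^ (α : ℂ) : ℂ) =
      ((y - N : ℝ) : ℂ) + (((y - α * N) * v : ℝ) : ℂ) * Complex.I + N * phase α v := by
  rw [phase]; push_cast; ring

lemma norm_cexp_exponent (α N y v : ℝ) :
    ‖Complex.exp (y * (1 + v * Complex.I) - N * (1 + v * Complex.I) ^ (α : ℂ))‖ =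
      Real.exp (y - N) * ‖Complex.exp (N * phase α v)‖ := by
  rw [exponent_eq_phase, Complex.exp_add, Complex.exp_add, norm_mul, norm_mul,
    Complex.norm_exp_ofReal_mul_I, Complex.norm_exp_ofReal, mul_one]

lemma integrable_norm_pow_mul_norm_cexp_phase {α N : ℝ} (h0 : 0 < α) (h1 : α < 1) (hN : 0 < N)
    (k : ℕ) :
    Integrable fun v : ℝ =>
      ‖(1 + v * Complex.I : ℂ)‖ ^ k * ‖Complex.exp (N * phase α v)‖ := by
  have hc := continuous_phase α
  refine (((integrable_abs_pow_mul_exp_phase h0 h1 hN 0).add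
    (integrable_abs_pow_mul_exp_phase h0 h1 hN k)).const_mul (2 ^ (k - 1))).mono'
    (by fun_prop) (Eventually.of_forall fun v => ?_)
  have hle : ‖(1 + v * Complex.I : ℂ)‖ ≤ 1 + |v| :=
    (norm_add_le _ _).trans (by simp)
  rw [Real.norm_of_nonneg (by positivity)]
  simp only [Pi.add_apply, pow_zero]
  rw [← add_mul, ← mul_assoc]
  gcongr
  calc ‖(1 + v * Complex.I : ℂ)‖ ^ k ≤ (1 + |v|) ^ k := by gcongr
    _ ≤ 2 ^ (k - 1) * (1 ^ k + |v| ^ k) := add_pow_le zero_le_one (abs_nonneg v) k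
    _ = _ := by rw [one_pow]

lemma continuous_one_add_mul_I_cpow (b : ℂ) :
    Continuous fun w : ℝ => (1 + w * Complex.I : ℂ) ^ b :=
  continuous_iff_continuousAt.2 fun v => (hasDerivAt_one_add_mul_I_cpow b v).continuousAt

lemma integrable_inversionIntegrand {α c : ℝ} (h0 : 0 < α) (h1 : α < 1) (hc : 0 < c) (k : ℕ)
    (x : ℝ) :
    Integrable fun v : ℝ => (1 + v * Complex.I : ℂ) ^ k *
      Complex.exp (c * x * (1 + v * Complex.I) - (c ^ α : ℝ) * (1 + v * Complex.I) ^ (α : ℂ)) := by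
  have hcont := continuous_one_add_mul_I_cpow α
  refine ((integrable_norm_pow_mul_norm_cexp_phase h0 h1 (Real.rpow_pos_of_pos hc α) k).const_mul
    (Real.exp (c * x - c ^ α))).mono' (by fun_prop) (Eventually.of_forall fun v => ?_)
  have e := norm_cexp_exponent α (c ^ α) (c * x) v
  rw [Complex.ofReal_mul] at e
  rw [norm_mul, norm_pow, e]
  exact le_of_eq (by ring)

lemma hasDerivAt_inversionIntegral {α c : ℝ} (h0 : 0 < α) (h1 : α < 1) (hc : 0 < c) (k : ℕ)
    (x : ℝ) :
    HasDerivAt (inversionIntegral α k c) (c * inversionIntegral α (k + 1) c x) x := by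
  have hcont := continuous_one_add_mul_I_cpow α
  have key := (hasDerivAt_integral_of_dominated_loc_of_deriv_le (μ := volume) (x₀ := x)
    (F := fun (y : ℝ) (v : ℝ) => (1 + v * Complex.I : ℂ) ^ k *
      Complex.exp (c * y * (1 + v * Complex.I) - (c ^ α : ℝ) * (1 + v * Complex.I) ^ (α : ℂ)))
    (F' := fun (y : ℝ) (v : ℝ) => c * ((1 + v * Complex.I : ℂ) ^ (k + 1) *
      Complex.exp (c * y * (1 + v * Complex.I) - (c ^ α : ℝ) * (1 + v * Complex.I) ^ (α : ℂ))))
    (bound := fun v : ℝ => c * Real.exp (c * (x + 1) - c ^ α) *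
      (‖(1 + v * Complex.I : ℂ)‖ ^ (k + 1) * ‖Complex.exp ((c ^ α : ℝ) * phase α v)‖))
    (s := Iio (x + 1)) (Iio_mem_nhds (by linarith))
    (Eventually.of_forall fun y => by fun_prop) (integrable_inversionIntegrand h0 h1 hc k x)
    (by fun_prop) (Eventually.of_forall fun v y hy => ?_)
    ((integrable_norm_pow_mul_norm_cexp_phase h0 h1 (Real.rpow_pos_of_pos hc α) (k + 1)).const_mul
      _) (Eventually.of_forall fun v y _ => ?_)).2
  · rw [integral_const_mul] at key
    exact key
  · have e := norm_cexp_exponent α (c ^ α) (c * y) v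
    rw [Complex.ofReal_mul] at e
    rw [norm_mul, norm_mul, norm_pow, e, Complex.norm_real, Real.norm_of_nonneg hc.le]
    calc _ = c * Real.exp (c * y - c ^ α) * (‖(1 + v * Complex.I : ℂ)‖ ^ (k + 1) *
          ‖Complex.exp ((c ^ α : ℝ) * phase α v)‖) := by ring
      _ ≤ _ := by
        have : y ≤ x + 1 := le_of_lt hy
        gcongr
  · have hy : HasDerivAt (fun y : ℝ => (y : ℂ)) 1 y := Complex.ofRealCLM.hasDerivAt
    refine (((((hy.const_mul (c : ℂ)).mul_const (1 + v * Complex.I)).sub_const _).cexp).const_mul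
      ((1 + v * Complex.I : ℂ) ^ k)).congr_deriv ?_
    ring

/-- On the line through the saddle point, where `c x = α c ^ α`. -/
lemma inversionIntegral_eq_of_saddle {α c x : ℝ} (hcx : c * x = α * c ^ α) (k : ℕ) :
    inversionIntegral α k c x = Complex.exp (((α - 1) * c ^ α : ℝ)) *
      ∫ v : ℝ, (1 + v * Complex.I) ^ k * Complex.exp ((c ^ α : ℝ) * phase α v) := by
  rw [inversionIntegral, ← integral_const_mul]
  congr 1; ext v
  have e := exponent_eq_phase α (c ^ α) (c * x) v
  rw [Complex.ofReal_mul] at e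
  have e2 : c * x - c ^ α = (α - 1) * c ^ α := by rw [hcx]; ring
  rw [e, e2, hcx, sub_self, zero_mul, Complex.ofReal_zero, zero_mul, add_zero, Complex.exp_add]
  ring

lemma integral_one_add_mul_I_pow_zero (α N : ℝ) :
    ∫ v : ℝ, (1 + v * Complex.I) ^ 0 * Complex.exp (N * phase α v) = saddleMoment α 0 N := by
  simp [saddleMoment]

lemma integral_one_add_mul_I_pow_one {α N : ℝ} (h0 : 0 < α) (h1 : α < 1) (hN : 0 < N) :
    ∫ v : ℝ, (1 + v * Complex.I) ^ 1 * Complex.exp (N * phase α v) =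
      saddleMoment α 0 N + Complex.I * saddleMoment α 1 N := by
  have hi := integrable_pow_mul_cexp_phase h0 h1 hN
  rw [saddleMoment, saddleMoment, ← integral_const_mul,
    ← integral_add (hi 0) ((hi 1).const_mul _)]
  congr 1; ext v; ring

lemma integral_one_add_mul_I_pow_two {α N : ℝ} (h0 : 0 < α) (h1 : α < 1) (hN : 0 < N) :
    ∫ v : ℝ, (1 + v * Complex.I) ^ 2 * Complex.exp (N * phase α v) =
      saddleMoment α 0 N + 2 * Complex.I * saddleMoment α 1 N - saddleMoment α 2 N := by
  have hi := integrable_pow_mul_cexp_phase h0 h1 hN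
  rw [saddleMoment, saddleMoment, saddleMoment, ← integral_const_mul,
    ← integral_add (hi 0) ((hi 1).const_mul _), ← integral_sub _ (hi 2)]
  · congr 1; ext v
    linear_combination (v : ℂ) ^ 2 * Complex.exp (N * phase α v) * Complex.I_mul_I
  · exact (hi 0).add ((hi 1).const_mul _)

/-! ### Laplace inversion for the stable density -/

lemma hasDerivAt_integral_cexp_neg_mul {f : ℝ → ℝ} (hf : IntegrableOn f (Ioi 0)) {z : ℂ}
    (hz : 0 < z.re) :
    HasDerivAt (fun z : ℂ => ∫ x in Ioi (0 : ℝ), Complex.exp (-(z * x)) * f x)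
      (∫ x in Ioi (0 : ℝ), -x * Complex.exp (-(z * x)) * f x) z := by
  have hm : AEStronglyMeasurable (fun x => (f x : ℂ)) (volume.restrict (Ioi 0)) :=
    hf.ofReal.aestronglyMeasurable
  have hnorm : ∀ (w : ℂ) (x : ℝ), ‖Complex.exp (-(w * x))‖ = Real.exp (-(w.re * x)) := by
    intro w x
    rw [Complex.norm_exp]; simp
  refine (hasDerivAt_integral_of_dominated_loc_of_deriv_le (μ := volume.restrict (Ioi 0))
    (F := fun (z : ℂ) (x : ℝ) => Complex.exp (-(z * x)) * (f x : ℂ))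
    (F' := fun (z : ℂ) (x : ℝ) => -x * Complex.exp (-(z * x)) * (f x : ℂ))
    (bound := fun x => (z.re / 2)⁻¹ * ‖f x‖)
    (s := {w : ℂ | z.re / 2 < w.re})
    ((isOpen_lt continuous_const Complex.continuous_re).mem_nhds (half_lt_self hz))
    (Eventually.of_forall fun w => ?_) ?_ ?_ ?_ (hf.norm.const_mul _) ?_).2
  · exact (Continuous.aestronglyMeasurable (by fun_prop)).mul hm
  · refine hf.norm.mono' ((Continuous.aestronglyMeasurable (by fun_prop)).mul hm) ?_
    refine (ae_restrict_iff' measurableSet_Ioi).2 (Eventually.of_forall fun x hx => ?_)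
    rw [norm_mul, hnorm, Complex.norm_real]
    refine mul_le_of_le_one_left (norm_nonneg _) (Real.exp_le_one_iff.2 ?_)
    have := mul_pos hz (mem_Ioi.1 hx)
    linarith
  · exact (Continuous.aestronglyMeasurable (by fun_prop)).mul hm
  · refine (ae_restrict_iff' measurableSet_Ioi).2 (Eventually.of_forall fun x hx w hw => ?_)
    have hx0 : 0 < x := hx
    have hw' : z.re / 2 < w.re := hw
    have hδ : 0 < z.re / 2 := half_pos hz
    rw [norm_mul, norm_mul, hnorm, norm_neg, Complex.norm_real, Complex.norm_real,
      Real.norm_of_nonneg hx0.le]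
    gcongr
    -- `δ x ≤ exp (δ x)` for `δ = Re z / 2`
    rw [Real.exp_neg, ← div_eq_mul_inv, div_le_iff₀ (Real.exp_pos _), inv_mul_eq_div,
      le_div_iff₀ hδ]
    calc x * (z.re / 2) ≤ w.re * x := by nlinarith
      _ ≤ _ := by linarith [Real.add_one_le_exp (w.re * x)]
  · refine Eventually.of_forall fun x w _ => ?_
    have hlin : HasDerivAt (fun w : ℂ => -(w * x)) (-x) w := by
      exact (hasDerivAt_mul_const (x : ℂ) (x := w)).neg
    exact (hlin.cexp.mul_const (f x : ℂ)).congr_deriv (by ring)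

/-- The Laplace transform of a stable density on the open right half-plane. -/
lemma IsOneSidedStableDensity.laplace_complex {α : ℝ} {f : ℝ → ℝ}
    (hf : IsOneSidedStableDensity α f) {z : ℂ} (hz : 0 < z.re) :
    ∫ x in Ioi (0 : ℝ), Complex.exp (-(z * x)) * f x = Complex.exp (-(z ^ (α : ℂ))) := by
  have hopen : IsOpen {w : ℂ | 0 < w.re} := isOpen_lt continuous_const Complex.continuous_re
  have hL : AnalyticOnNhd ℂ (fun z : ℂ => ∫ x in Ioi (0 : ℝ), Complex.exp (-(z * x)) * f x)
      {w : ℂ | 0 < w.re} :=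
    DifferentiableOn.analyticOnNhd (fun w hw =>
      (hasDerivAt_integral_cexp_neg_mul hf.integrableOn hw).differentiableAt.differentiableWithinAt)
      hopen
  have hR : AnalyticOnNhd ℂ (fun z : ℂ => Complex.exp (-(z ^ (α : ℂ)))) {w : ℂ | 0 < w.re} :=
    DifferentiableOn.analyticOnNhd (fun w hw =>
      (((hasDerivAt_id w).cpow_const (c := (α : ℂ))
        (Or.inl hw)).neg.cexp).differentiableAt.differentiableWithinAt) hopen
  refine hL.eqOn_of_preconnected_of_frequently_eq hR
    (convex_halfSpace_re_gt 0).isPreconnected (z₀ := 1) (by simp) ?_ hz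
  -- both sides agree at the real points near `1`
  have ht : Tendsto (fun x : ℝ => (x : ℂ)) (nhdsWithin 1 {1}ᶜ) (nhdsWithin 1 {1}ᶜ) := by
    refine tendsto_nhdsWithin_iff.2 ⟨?_, ?_⟩
    · exact (Complex.continuous_ofReal.tendsto' 1 1 (by simp)).mono_left nhdsWithin_le_nhds
    · filter_upwards [self_mem_nhdsWithin] with x hx
      simpa using hx
  refine ht.frequently (Eventually.frequently ?_)
  filter_upwards [nhdsWithin_le_nhds (lt_mem_nhds (zero_lt_one (α := ℝ)))] with l hl
  rw [← Complex.ofReal_cpow hl.le, ← Complex.ofReal_neg, ← Complex.ofReal_exp, ← hf.laplace l hl.le,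
    ← integral_complex_ofReal]
  congr 1; ext x; push_cast; rfl

lemma ofReal_mul_one_add_cpow {c : ℝ} (hc : 0 < c) (α v : ℝ) :
    ((c : ℂ) * (1 + v * Complex.I)) ^ (α : ℂ) =
      (c ^ α : ℝ) * (1 + v * Complex.I) ^ (α : ℂ) := by
  have hcc : (c : ℂ) ≠ 0 := by exact_mod_cast hc.ne'
  rw [Complex.cpow_def_of_ne_zero (mul_ne_zero hcc (one_add_mul_I_ne_zero v)),
    Complex.cpow_def_of_ne_zero (one_add_mul_I_ne_zero v),
    Complex.log_ofReal_mul hc (one_add_mul_I_ne_zero v), add_mul, Complex.exp_add,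
    Real.rpow_def_of_pos hc]
  push_cast; rfl

open FourierTransform in
/-- Laplace inversion along any vertical line in the right half-plane, from Fourier inversion for
`x ↦ exp (- c x) f x`. -/
lemma IsOneSidedStableDensity.eq_inversionIntegral {α : ℝ} {f : ℝ → ℝ} (h0 : 0 < α) (h1 : α < 1)
    (hf : IsOneSidedStableDensity α f) {c x : ℝ} (hc : 0 < c) (hx : 0 < x) :
    (f x : ℂ) = c / (2 * Real.pi) * inversionIntegral α 0 c x := by
  let u : ℝ → ℂ := (Ioi 0).indicator fun y : ℝ => Complex.exp (-(c * y)) * f y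
  have hπ : 0 < 2 * Real.pi := by positivity
  have hu : Integrable u := by
    rw [integrable_indicator_iff measurableSet_Ioi]
    refine hf.integrableOn.norm.mono' ((Continuous.aestronglyMeasurable (by fun_prop)).mul
      hf.integrableOn.ofReal.aestronglyMeasurable) ?_
    refine (ae_restrict_iff' measurableSet_Ioi).2 (Eventually.of_forall fun y hy => ?_)
    rw [norm_mul, ← Complex.ofReal_mul, ← Complex.ofReal_neg, Complex.norm_exp_ofReal,
      Complex.norm_real]
    refine mul_le_of_le_one_left (norm_nonneg _) (Real.exp_le_one_iff.2 ?_)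
    have := mul_pos hc (mem_Ioi.1 hy)
    linarith
  have huc : ContinuousAt u x := by
    have : ContinuousAt (fun y : ℝ => Complex.exp (-(c * y)) * (f y : ℂ)) x :=
      ContinuousAt.mul (by fun_prop) (Complex.continuous_ofReal.continuousAt.comp
        (hf.continuousOn.continuousAt (Ioi_mem_nhds hx)))
    refine this.congr ?_
    filter_upwards [Ioi_mem_nhds hx] with y hy
    exact (indicator_of_mem (mem_Ioi.2 hy)
      (fun y : ℝ => Complex.exp (-(c * y)) * (f y : ℂ))).symm
  have hF : 𝓕 u = fun ξ : ℝ => Complex.exp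
      (-((c ^ α : ℝ) * (1 + ((2 * Real.pi / c * ξ : ℝ) : ℂ) * Complex.I) ^ (α : ℂ))) := by
    ext ξ
    have hcc : (c : ℂ) ≠ 0 := by exact_mod_cast hc.ne'
    rw [← ofReal_mul_one_add_cpow hc,
      ← hf.laplace_complex (z := c * (1 + ((2 * Real.pi / c * ξ : ℝ) : ℂ) * Complex.I))
        (by simpa using hc), Real.fourier_real_eq_integral_exp_smul,
      ← integral_indicator measurableSet_Ioi]
    congr 1; ext y
    by_cases hy : y ∈ Ioi (0 : ℝ)
    · simp only [u, indicator_of_mem hy, smul_eq_mul]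
      rw [← mul_assoc, ← Complex.exp_add]
      congr 2
      push_cast
      field_simp
      ring
    · simp [u, indicator_of_notMem hy]
  have hFi : Integrable (𝓕 u) := by
    rw [hF]
    have := (integrable_inversionIntegrand h0 h1 hc 0 0).comp_mul_left'
      (R := 2 * Real.pi / c) (by positivity)
    simpa using this
  have hinv := hu.fourierInv_fourier_eq hFi huc
  rw [Real.fourierInv_eq', hF] at hinv
  -- substitute `ξ = c v / (2 π)` for the frequency `ξ`
  have hsub := Measure.integral_comp_mul_left (fun v : ℝ => Complex.exp (-(c * x)) *
    ((1 + v * Complex.I) ^ 0 * Complex.exp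
      (c * x * (1 + v * Complex.I) - (c ^ α : ℝ) * (1 + v * Complex.I) ^ (α : ℂ))))
    (2 * Real.pi / c)
  rw [inv_div, abs_of_pos (by positivity), Complex.real_smul] at hsub
  have hux : u x = Complex.exp (-(c * x)) * f x := indicator_of_mem (mem_Ioi.2 hx) _
  rw [hux] at hinv
  have hne := Complex.exp_ne_zero (-(c * x : ℂ))
  refine mul_left_cancel₀ hne ?_
  rw [← hinv]
  push_cast at hsub
  rw [mul_left_comm, inversionIntegral, ← integral_const_mul, ← hsub]
  congr 1; ext ξ
  rw [smul_eq_mul, pow_zero, one_mul, ← Complex.exp_add, ← Complex.exp_add]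
  congr 1
  have hcc : (c : ℂ) ≠ 0 := by exact_mod_cast hc.ne'
  simp
  field_simp
  ring

/-! ### Derivatives of the density -/

lemma hasDerivAt_re_of_ofReal_eq {h : ℝ → ℝ} {G : ℝ → ℂ} {G' : ℂ} {x : ℝ}
    (hG : HasDerivAt G G' x) (hh : ∀ᶠ y in nhds x, (h y : ℂ) = G y) :
    HasDerivAt h G'.re x ∧ ((G'.re : ℝ) : ℂ) = G' := by
  have h1 : HasDerivAt (fun y => (h y : ℂ)) G' x := hG.congr_of_eventuallyEq hh
  have h2 : HasDerivAt h G'.re x := Complex.reCLM.hasFDerivAt.comp_hasDerivAt x h1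
  exact ⟨h2, h2.ofReal_comp.unique h1⟩

lemma IsOneSidedStableDensity.eq_inversionIntegral_zero {α : ℝ} {f : ℝ → ℝ} (h0 : 0 < α)
    (h1 : α < 1) (hf : IsOneSidedStableDensity α f) (c x : ℝ) (hc : 0 < c) (hx : 0 < x) :
    (f x : ℂ) = c ^ (0 + 1) / (2 * Real.pi) * inversionIntegral α 0 c x := by
  simpa using hf.eq_inversionIntegral h0 h1 hc hx

/-- If `h` is given by the inversion integral with weight `z ^ k` on all vertical lines, then its
derivative is given by the one with weight `z ^ (k + 1)`. -/
lemma hasDerivAt_of_eq_inversionIntegral {α : ℝ} {h : ℝ → ℝ} (h0 : 0 < α) (h1 : α < 1) {k : ℕ}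
    (hh : ∀ c x : ℝ, 0 < c → 0 < x →
      (h x : ℂ) = c ^ (k + 1) / (2 * Real.pi) * inversionIntegral α k c x) {c x : ℝ}
    (hc : 0 < c) (hx : 0 < x) :
    HasDerivAt h (deriv h x) x ∧
      ((deriv h x : ℝ) : ℂ) =
        c ^ (k + 1 + 1) / (2 * Real.pi) * inversionIntegral α (k + 1) c x := by
  obtain ⟨hd, he⟩ := hasDerivAt_re_of_ofReal_eq (h := h)
    ((hasDerivAt_inversionIntegral h0 h1 hc k x).const_mul (c ^ (k + 1) / (2 * Real.pi) : ℂ))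
    (by filter_upwards [lt_mem_nhds hx] with y hy using hh c y hc hy)
  rw [hd.deriv]
  refine ⟨hd, he.trans (by ring)⟩

lemma IsOneSidedStableDensity.hasDerivAt_deriv {α : ℝ} {f : ℝ → ℝ} (h0 : 0 < α) (h1 : α < 1)
    (hf : IsOneSidedStableDensity α f) :
    (∀ x, 0 < x → HasDerivAt f (deriv f x) x) ∧
    (∀ x, 0 < x → HasDerivAt (deriv f) (deriv (deriv f) x) x) ∧
    ContinuousOn (deriv (deriv f)) (Ioi 0) := by
  have H0 := hf.eq_inversionIntegral_zero h0 h1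
  have H1 := fun c x hc hx =>
    (hasDerivAt_of_eq_inversionIntegral (c := c) (x := x) h0 h1 H0 hc hx).2
  have H2 := fun c x hc hx =>
    (hasDerivAt_of_eq_inversionIntegral (c := c) (x := x) h0 h1 H1 hc hx).2
  exact ⟨fun x hx => (hasDerivAt_of_eq_inversionIntegral h0 h1 H0 one_pos hx).1,
    fun x hx => (hasDerivAt_of_eq_inversionIntegral h0 h1 H1 one_pos hx).1,
    fun x hx => (hasDerivAt_of_eq_inversionIntegral h0 h1 H2 one_pos
      hx).1.continuousAt.continuousWithinAt⟩

/-! ### The logarithm of the density in exponential coordinates -/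

lemma hasDerivAt_log_comp_exp {f : ℝ → ℝ} {t f' : ℝ} (hf : HasDerivAt f f' (Real.exp t))
    (hpos : 0 < f (Real.exp t)) :
    HasDerivAt (fun s => Real.log (f (Real.exp s))) (Real.exp t * f' / f (Real.exp t)) t :=
  ((hf.comp t (Real.hasDerivAt_exp t)).log hpos.ne').congr_deriv (by simp [mul_comm])

lemma hasDerivAt_exp_mul_deriv_div {f f₁ : ℝ → ℝ} {t f₂ : ℝ}
    (hf : HasDerivAt f (f₁ (Real.exp t)) (Real.exp t))
    (hf₁ : HasDerivAt f₁ f₂ (Real.exp t)) (hpos : 0 < f (Real.exp t)) :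
    HasDerivAt (fun s => Real.exp s * f₁ (Real.exp s) / f (Real.exp s))
      (Real.exp t * f₁ (Real.exp t) / f (Real.exp t) + Real.exp t ^ 2 * f₂ / f (Real.exp t) -
        (Real.exp t * f₁ (Real.exp t) / f (Real.exp t)) ^ 2) t := by
  have he := Real.hasDerivAt_exp t
  refine ((he.mul (hf₁.comp t he)).div (hf.comp t he) hpos.ne').congr_deriv ?_
  have := hpos.ne'
  simp only [Function.comp_apply, Pi.mul_apply]
  field_simp

/-- `c ^ α` at the saddle point `c` of `z ↦ z exp t - z ^ α`. -/
noncomputable def saddleSize (α t : ℝ) : ℝ :=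
  Real.exp ((t - Real.log α) / (α - 1)) ^ α

lemma saddleSize_pos (α t : ℝ) : 0 < saddleSize α t := Real.rpow_pos_of_pos (Real.exp_pos _) α

lemma saddle_mul_exp_eq {α : ℝ} (h0 : 0 < α) (h1 : α < 1) (t : ℝ) :
    Real.exp ((t - Real.log α) / (α - 1)) * Real.exp t = α * saddleSize α t := by
  have h : α - 1 ≠ 0 := by linarith
  rw [saddleSize, ← Real.exp_mul]
  nth_rewrite 3 [← Real.exp_log h0]
  rw [← Real.exp_add, ← Real.exp_add]
  congr 1
  field_simp
  ring

lemma mul_saddleSize_eq {α : ℝ} (h0 : 0 < α) (h1 : α < 1) (t : ℝ) :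
    α * saddleSize α t = α ^ (1 / (1 - α)) * Real.exp (α / (α - 1) * t) := by
  have h : α - 1 ≠ 0 := by linarith
  have h' : 1 - α ≠ 0 := by linarith
  rw [← saddle_mul_exp_eq h0 h1, Real.rpow_def_of_pos h0, ← Real.exp_add, ← Real.exp_add,
    ← neg_sub 1 α]
  congr 1
  field_simp
  ring

lemma tendsto_saddleSize {α : ℝ} (h0 : 0 < α) (h1 : α < 1) :
    Tendsto (saddleSize α) atBot atTop := by
  have h : Tendsto (fun t => (t - Real.log α) / (α - 1)) atBot atTop := by
    have hs : Tendsto (fun t : ℝ => t - Real.log α) atBot atBot :=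
      tendsto_atBot_add_const_right _ (-Real.log α) tendsto_id
    exact hs.atBot_mul_const_of_neg (inv_lt_zero.2 (by linarith))
  exact (tendsto_rpow_atTop h0).comp (Real.tendsto_exp_atTop.comp h)

/-- The logarithmic derivatives of `f` at `exp t` in terms of the saddle point moments. -/
lemma IsOneSidedStableDensity.log_deriv_eq {α : ℝ} {f : ℝ → ℝ} (h0 : 0 < α) (h1 : α < 1)
    (hf : IsOneSidedStableDensity α f) (t : ℝ) :
    ((Real.exp t * deriv f (Real.exp t) / f (Real.exp t) : ℝ) : ℂ) = α * saddleSize α t *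
      (1 + Complex.I * (saddleMoment α 1 (saddleSize α t) / saddleMoment α 0 (saddleSize α t))) ∧
    ((Real.exp t ^ 2 * deriv (deriv f) (Real.exp t) / f (Real.exp t) : ℝ) : ℂ) =
      (α * saddleSize α t) ^ 2 *
      (1 + 2 * Complex.I * (saddleMoment α 1 (saddleSize α t) / saddleMoment α 0 (saddleSize α t))
        - saddleMoment α 2 (saddleSize α t) / saddleMoment α 0 (saddleSize α t)) := by
  have hx := Real.exp_pos t
  have hN := saddleSize_pos α t
  have hcx := saddle_mul_exp_eq h0 h1 t
  have hcN : saddleSize α t = Real.exp ((t - Real.log α) / (α - 1)) ^ α := rfl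
  set c := Real.exp ((t - Real.log α) / (α - 1))
  set N := saddleSize α t
  set x := Real.exp t
  have hc : 0 < c := Real.exp_pos _
  have H0 := hf.eq_inversionIntegral_zero h0 h1
  have H1 : ∀ c x : ℝ, 0 < c → 0 < x →
      ((deriv f x : ℝ) : ℂ) = c ^ (0 + 1 + 1) / (2 * Real.pi) * inversionIntegral α (0 + 1) c x :=
    fun c x hc hx => (hasDerivAt_of_eq_inversionIntegral h0 h1 H0 hc hx).2
  have H2 := (hasDerivAt_of_eq_inversionIntegral h0 h1 H1 hc hx).2
  have E0 := H0 c x hc hx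
  have E1 := H1 c x hc hx
  have hfx : (f x : ℂ) ≠ 0 := by exact_mod_cast (hf.pos x hx).ne'
  have hcx' : c * x = α * c ^ α := by rw [← hcN]; exact hcx
  rw [inversionIntegral_eq_of_saddle hcx', ← hcN] at E0 E1 H2
  rw [integral_one_add_mul_I_pow_zero] at E0
  rw [zero_add, integral_one_add_mul_I_pow_one h0 h1 hN] at E1
  rw [show 0 + 1 + 1 = 2 from rfl, integral_one_add_mul_I_pow_two h0 h1 hN] at H2
  have hexp := Complex.exp_ne_zero (((α - 1) * N : ℝ) : ℂ)
  have hA : saddleMoment α 0 N ≠ 0 := by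
    intro h
    rw [h] at E0
    exact hfx (by simpa using E0)
  have hcc : (c : ℂ) ≠ 0 := by exact_mod_cast hc.ne'
  have hπ : (Real.pi : ℂ) ≠ 0 := by exact_mod_cast Real.pi_ne_zero
  -- `x f' / f` and `x ^ 2 f'' / f` carry the factors `c x = α N` and `(c x) ^ 2`
  have hcxc : (α * N : ℂ) = c * x := by exact_mod_cast hcx.symm
  constructor
  · push_cast
    rw [E0, E1, hcxc]
    field_simp
    ring
  · push_cast
    rw [E0, H2, hcxc]
    field_simp
    ring

/-- Both logarithmic derivatives up to errors of order `1` and `√N`, where `N = saddleSize α t`. -/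
lemma IsOneSidedStableDensity.exists_abs_log_deriv_sub_le {α : ℝ} {f : ℝ → ℝ} (h0 : 0 < α)
    (h1 : α < 1) (hf : IsOneSidedStableDensity α f) :
    ∃ C D : ℝ, ∀ᶠ t in atBot,
      |Real.exp t * deriv f (Real.exp t) / f (Real.exp t) - α * saddleSize α t| ≤ C ∧
      |(Real.exp t * deriv f (Real.exp t) / f (Real.exp t) +
          Real.exp t ^ 2 * deriv (deriv f) (Real.exp t) / f (Real.exp t) -
          (Real.exp t * deriv f (Real.exp t) / f (Real.exp t)) ^ 2) +
        α ^ 2 / (1 - α) * saddleSize α t| ≤ C + C ^ 2 + D * √(saddleSize α t) := by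
  obtain ⟨C, hC, hp⟩ := exists_norm_saddleMoment_one_div_le h0 h1
  obtain ⟨D, hD, hq⟩ := exists_norm_saddleMoment_two_div_sub_le h0 h1
  refine ⟨α * C, α / (1 - α) * D, ?_⟩
  have hlim := tendsto_saddleSize h0 h1
  filter_upwards [hlim.eventually hp, hlim.eventually hq] with t hp hq
  obtain ⟨e1, e2⟩ := hf.log_deriv_eq h0 h1 t
  have hN := saddleSize_pos α t
  set N := saddleSize α t
  set g := Real.exp t * deriv f (Real.exp t) / f (Real.exp t)
  set k := Real.exp t ^ 2 * deriv (deriv f) (Real.exp t) / f (Real.exp t)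
  set p := saddleMoment α 1 N / saddleMoment α 0 N
  set q := saddleMoment α 2 N / saddleMoment α 0 N
  have h1' : 0 < 1 - α := sub_pos.2 h1
  have hs : 0 < √N := Real.sqrt_pos.2 hN
  have hNp : N * ‖p‖ ≤ C := by
    have := mul_le_mul_of_nonneg_left hp hN.le
    rwa [mul_left_comm, mul_inv_cancel₀ hN.ne', mul_one] at this
  have hNq : N * ‖(N * (α * (1 - α)) * q - 1 : ℂ)‖ ≤ D * √N := by
    have := mul_le_mul_of_nonneg_left hq hN.le
    rwa [mul_left_comm N D, ← div_eq_mul_inv, Real.div_sqrt] at this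
  -- the error term of the first derivative, which enters the second one with its square
  have hbound : ‖(α * N * (Complex.I * p) : ℂ)‖ ≤ α * C := by
    rw [norm_mul, norm_mul, norm_mul, Complex.norm_real, Complex.norm_real, Complex.norm_I,
      Real.norm_of_nonneg h0.le, Real.norm_of_nonneg hN.le, one_mul, mul_assoc]
    gcongr
  constructor
  · rw [← Real.norm_eq_abs, ← Complex.norm_real]
    refine le_trans (le_of_eq ?_) hbound
    congr 1
    push_cast at e1 ⊢
    rw [e1]; ring
  · rw [← Real.norm_eq_abs, ← Complex.norm_real]
    have hαc : (1 - α : ℂ) ≠ 0 := by exact_mod_cast h1'.ne'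
    have e : ((g + k - g ^ 2 + α ^ 2 / (1 - α) * N : ℝ) : ℂ) =
        α * N * (Complex.I * p) - (α * N * (Complex.I * p)) ^ 2 -
          (α / (1 - α) : ℝ) * (N * (N * (α * (1 - α)) * q - 1)) := by
      rw [Complex.ofReal_add, Complex.ofReal_sub, Complex.ofReal_add, Complex.ofReal_pow, e1, e2]
      push_cast
      field_simp
      ring
    rw [e]
    refine (norm_sub_le _ _).trans (add_le_add ((norm_sub_le _ _).trans
      (add_le_add hbound ?_)) ?_)
    · rw [norm_pow]
      gcongr
    · rw [norm_mul, norm_mul, Complex.norm_real, Complex.norm_real,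
        Real.norm_of_nonneg (div_pos h0 h1').le, Real.norm_of_nonneg hN.le,
        mul_assoc (α / (1 - α))]
      gcongr

/-! ### Asymptotics at `-∞` -/

theorem propositionA3 (α : ℝ) (hα0 : 0 < α) (hα : α ≤ 1 / 2)
    (f : ℝ → ℝ) (hf : IsOneSidedStableDensity α f) :
    ContDiff ℝ 2 (fun t : ℝ => Real.log (f (Real.exp t))) ∧
    (fun t : ℝ => deriv (fun s : ℝ => Real.log (f (Real.exp s))) t -
        α ^ (1 / (1 - α)) * Real.exp (α / (α - 1) * t)) =O[atBot] (fun _ : ℝ => (1 : ℝ)) ∧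
    Tendsto (iteratedDeriv 2 (fun t : ℝ => Real.log (f (Real.exp t)))) atBot atBot := by
  have h1 : α < 1 := by linarith
  obtain ⟨hd0, hd1, hc2⟩ := hf.hasDerivAt_deriv hα0 h1
  have hg : ∀ t, HasDerivAt (fun s => Real.log (f (Real.exp s)))
      (Real.exp t * deriv f (Real.exp t) / f (Real.exp t)) t := fun t =>
    hasDerivAt_log_comp_exp (hd0 _ (Real.exp_pos t)) (hf.pos _ (Real.exp_pos t))
  have hg' : ∀ t, HasDerivAt (fun t => Real.exp t * deriv f (Real.exp t) / f (Real.exp t))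
      (Real.exp t * deriv f (Real.exp t) / f (Real.exp t) +
        Real.exp t ^ 2 * deriv (deriv f) (Real.exp t) / f (Real.exp t) -
        (Real.exp t * deriv f (Real.exp t) / f (Real.exp t)) ^ 2) t := fun t =>
    hasDerivAt_exp_mul_deriv_div (hd0 _ (Real.exp_pos t)) (hd1 _ (Real.exp_pos t))
      (hf.pos _ (Real.exp_pos t))
  have hdg : deriv (fun s => Real.log (f (Real.exp s))) =
      fun t => Real.exp t * deriv f (Real.exp t) / f (Real.exp t) := funext fun t => (hg t).deriv
  have hdg' := funext fun t => (hg' t).deriv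
  obtain ⟨C, D, hCD⟩ := hf.exists_abs_log_deriv_sub_le hα0 h1
  refine ⟨?_, ?_, ?_⟩
  · have hc0 : Continuous fun t => f (Real.exp t) := hf.continuousOn.comp_continuous
      Real.continuous_exp Real.exp_pos
    have hcg : Continuous fun t => Real.exp t * deriv f (Real.exp t) / f (Real.exp t) :=
      continuous_iff_continuousAt.2 fun t => (hg' t).continuousAt
    have hc2' : Continuous fun t => deriv (deriv f) (Real.exp t) := hc2.comp_continuous
      Real.continuous_exp Real.exp_pos
    rw [show (2 : WithTop ℕ∞) = 1 + 1 by norm_num, contDiff_succ_iff_deriv]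
    refine ⟨fun t => (hg t).differentiableAt, by simp, ?_⟩
    rw [hdg, contDiff_one_iff_deriv]
    refine ⟨fun t => (hg' t).differentiableAt, ?_⟩
    rw [hdg']
    exact (hcg.add (((Real.continuous_exp.pow 2).mul hc2').div₀ hc0
      fun t => (hf.pos _ (Real.exp_pos t)).ne')).sub (hcg.pow 2)
  · rw [isBigO_one_iff]
    refine isBoundedUnder_of_eventually_le (a := C) ?_
    filter_upwards [hCD] with t ht
    rw [(hg t).deriv, ← mul_saddleSize_eq hα0 h1]
    exact ht.1
  · have e : iteratedDeriv 2 (fun t : ℝ => Real.log (f (Real.exp t))) = fun t =>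
        Real.exp t * deriv f (Real.exp t) / f (Real.exp t) +
        Real.exp t ^ 2 * deriv (deriv f) (Real.exp t) / f (Real.exp t) -
        (Real.exp t * deriv f (Real.exp t) / f (Real.exp t)) ^ 2 := by
      rw [iteratedDeriv_succ, iteratedDeriv_one, hdg, hdg']
    rw [e]
    have ha : 0 < α ^ 2 / (1 - α) := div_pos (by positivity) (by linarith)
    have hs : Tendsto (fun t => √(saddleSize α t)) atBot atTop :=
      Real.tendsto_sqrt_atTop.comp (tendsto_saddleSize hα0 h1)
    have hlim : Tendsto (fun t => √(saddleSize α t) *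
        (-(α ^ 2 / (1 - α)) * √(saddleSize α t) + D) + (C + C ^ 2)) atBot atBot :=
      tendsto_atBot_add_const_right _ _ (hs.atTop_mul_atBot₀
        (tendsto_atBot_add_const_right _ _ (hs.const_mul_atTop_of_neg (neg_lt_zero.2 ha))))
    refine tendsto_atBot_mono' _ ?_ hlim
    filter_upwards [hCD] with t ht
    have h := (abs_le.1 ht.2).2
    have hsq := Real.sq_sqrt (saddleSize_pos α t).le
    nlinarith
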